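/- For integers $p,q\ge 0$ let $\mathbb G_{p,q}$ be the universal real geometric algebra (Clifford algebra) of $\mathbb R^{p,q}$: the unital associative real algebra with pairwise anticommuting generators $e_1,\dots,e_p,f_1,\dots,f_q$ with $e_i^2=+1$, $f_j^2=-1$ and no further relations. For an algebra $K$ let ${}^2K=K\times K$ with componentwise operations, and let $M_m(K)$ be the algebra of $m\times m$ matrices over $K$, with $M_1(K)=K$. (a) For all $p,q\ge 0$ with $p+q\le 7$, the algebra $\mathbb G_{p,q}$ is isomorphic, as a real algebra, to the corresponding entry of the following table. Row $n$ lists the entries for $\mathbb G_{n,0},\mathbb G_{n-1,1},\dots,\mathbb G_{0,n}$, in this order. - $n=0$: $\mathbb R$ - $n=1$: ${}^2\mathbb R,\ \mathbb C$ - $n=2$: $M_2(\mathbb R),\ M_2(\mathbb R),\ \mathbb H$ - $n=3$: $M_2(\mathbb C),\ M_2({}^2\mathbb R),\ M_2(\mathbb C),\ {}^2\mathbb H$ - $n=4$: $M_2(\mathbb H),\ M_4(\mathbb R),\ M_4(\mathbb R),\ M_2(\mathbb H),\ M_2(\mathbb H)$ - $n=5$: $M_2({}^2\mathbb H),\ M_4(\mathbb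 C),\ M_4({}^2\mathbb R),\ M_4(\mathbb C),\ M_2({}^2\mathbb H),\ M_4(\mathbb C)$ - $n=6$: $M_4(\mathbb H),\ M_4(\mathbb H),\ M_8(\mathbb R),\ M_8(\mathbb R),\ M_4(\mathbb H),\ M_4(\mathbb H),\ M_8(\mathbb R)$ - $n=7$: $M_8(\mathbb C),\ M_4({}^2\mathbb H),\ M_8(\mathbb C),\ M_8({}^2\mathbb R),\ M_8(\mathbb C),\ M_4({}^2\mathbb H),\ M_8(\mathbb C),\ M_8({}^2\mathbb R)$ (b) For $p+q\le 7$ the square of the pseudoscalar $e_1\cdots e_p f_1\cdots f_q$ of $\mathbb G_{p,q}$ is the scalar given by the sign below the column $p-q$: $$\begin{array}{c|ccccccccccccccc} p-q&7&6&5&4&3&2&1&0&-1&-2&-3&-4&-5&-6&-7\\ \hline \text{square}&-&-&+&+&-&-&+&+&-&-&+&+&-&-&+\end{array}$$ (c) The Clifford clock encodes the same classification. Let the eight hours of the clock, clockwise from the top, carry the blocks $\mathbb R,\mathbb C,\mathbb H,{}^2\mathbb H,\mathbb H,\mathbb C,\mathbb R,{}^2\mathbb R$. For $p+q\le 7$,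 let $K_{p,q}$ be the block reached from the top after $q$ hours clockwise followed by $p$ hours counterclockwise. Then the entry of the table in (a) for $\mathbb G_{p,q}$ is $M_m(K)$ if and only if $K=K_{p,q}$ and $m^2\dim_{\mathbb R}K=2^{p+q}$. -/

import Mathlib

namespace GeometricAlgebra

/-- The standard quadratic form of signature `(p, q)` on `ℝ^{p,q}`:
`x₁² + ⋯ + x_p² - y₁² - ⋯ - y_q²`. -/
noncomputable def signatureForm (p q : ℕ) : QuadraticForm ℝ (Fin p ⊕ Fin q → ℝ) :=
  QuadraticMap.weightedSumSquares ℝ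
    (Sum.elim (fun _ : Fin p => (1 : ℝ)) (fun _ : Fin q => (-1 : ℝ)))

/-- The universal real geometric algebra `𝔾_{p,q}`, generated by `p` square roots of `+1` and
`q` square roots of `-1`, all of them pairwise anticommuting. -/
abbrev G (p q : ℕ) : Type := CliffordAlgebra (signatureForm p q)

/-- The generators `e₁, …, e_p`, with square `+1`. -/
noncomputable def e {p q : ℕ} (i : Fin p) : G p q :=
  CliffordAlgebra.ι (signatureForm p q) (Pi.single (Sum.inl i) 1)

/-- The generators `f₁, …, f_q`, with square `-1`. -/
noncomputable def f {p q : ℕ} (j : Fin q) : G p q :=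
  CliffordAlgebra.ι (signatureForm p q) (Pi.single (Sum.inr j) 1)

/-- The pseudoscalar `e₁ ⋯ e_p f₁ ⋯ f_q` of `𝔾_{p,q}`. -/
noncomputable def pseudoscalar (p q : ℕ) : G p q :=
  (List.ofFn fun i : Fin p => (e i : G p q)).prod *
    (List.ofFn fun j : Fin q => (f j : G p q)).prod

/-- Names of the five building blocks `ℝ`, `²ℝ`, `ℂ`, `ℍ`, `²ℍ`. -/
inductive Block
  | real
  | doubleReal
  | complex
  | quaternion
  | doubleQuaternion

/-- `A` is isomorphic, as a real algebra, to the algebra of `m × m` matrices over the given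
building block; the double `²K` of a ring `K` is `K × K` with componentwise operations. -/
def IsMatrixAlgebraOver (A : Type) [Ring A] [Algebra ℝ A] (m : ℕ) : Block → Prop
  | .real => Nonempty (A ≃ₐ[ℝ] Matrix (Fin m) (Fin m) ℝ)
  | .doubleReal => Nonempty (A ≃ₐ[ℝ] Matrix (Fin m) (Fin m) (ℝ × ℝ))
  | .complex => Nonempty (A ≃ₐ[ℝ] Matrix (Fin m) (Fin m) ℂ)
  | .quaternion => Nonempty (A ≃ₐ[ℝ] Matrix (Fin m) (Fin m) (Quaternion ℝ))
  | .doubleQuaternion =>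
      Nonempty (A ≃ₐ[ℝ] Matrix (Fin m) (Fin m) (Quaternion ℝ × Quaternion ℝ))

/-- The real dimension of a building block. -/
noncomputable def Block.dim : Block → ℕ
  | .real => Module.finrank ℝ ℝ
  | .doubleReal => Module.finrank ℝ (ℝ × ℝ)
  | .complex => Module.finrank ℝ ℂ
  | .quaternion => Module.finrank ℝ (Quaternion ℝ)
  | .doubleQuaternion => Module.finrank ℝ (Quaternion ℝ × Quaternion ℝ)

open Block in
/-- The periodic table of real geometric algebras. Row `n` (for `n = 0, …, 7`) lists the entries
of `𝔾_{n,0}, 𝔾_{n-1,1}, …, 𝔾_{0,n}`; the entry `(m, K)` stands for `M_m(K)`. -/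
def periodicTable : List (List (ℕ × Block)) :=
  [ [(1, real)],
    [(1, doubleReal), (1, complex)],
    [(2, real), (2, real), (1, quaternion)],
    [(2, complex), (2, doubleReal), (2, complex), (1, doubleQuaternion)],
    [(2, quaternion), (4, real), (4, real), (2, quaternion), (2, quaternion)],
    [(2, doubleQuaternion), (4, complex), (4, doubleReal), (4, complex), (2, doubleQuaternion),
      (4, complex)],
    [(4, quaternion), (4, quaternion), (8, real), (8, real), (4, quaternion), (4, quaternion),
      (8, real)],
    [(8, complex), (4, doubleQuaternion), (8, complex), (8, doubleReal), (8, complex),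
      (4, doubleQuaternion), (8, complex), (8, doubleReal)] ]

/-- The entry of the periodic table at `𝔾_{p,q}`: row `p + q`, position `q` in that row. -/
def tableEntry (p q : ℕ) : Option (ℕ × Block) :=
  (periodicTable[p + q]?).bind fun row => row[q]?

/-- The last line of the periodic table: the sign of the square of the pseudoscalar, in the
columns `p - q = 7, 6, …, -6, -7`. -/
def signRow : List ℤ :=
  [-1, -1, 1, 1, -1, -1, 1, 1, -1, -1, 1, 1, -1, -1, 1]

open Block in
/-- The Clifford clock: the eight building blocks met clockwise, starting from the top. -/
def cliffordClock : ZMod 8 → Block :=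
  ![real, complex, quaternion, doubleQuaternion, quaternion, complex, real, doubleReal]

end GeometricAlgebra

/-! An algebra is recognised as `G p q` by internal data: anticommuting generators with the right
squares, together with dimension `2 ^ (p + q)`. The universal property maps `G p q` onto such an
algebra, and equality of dimensions makes the map injective (`IsCliffordFamily.nonempty_algEquiv`).

Working with families of generators rather than with isomorphisms makes three recursions explicit.
Passing to `2 × 2` matrices gives (p, q) → (p+1, q+1) and (p, q) → (q+2, p), both instances of
`IsCliffordFamily.matrix`. Multiplying four positive generators by their product gives (p+4, q) →
(p, q+4) without changing the algebra (`IsCliffordFamily.exchange`). Starting from ℝ, ²ℝ, ℂ, ℍ and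
²ℍ these reach every signature with p + q ≤ 7.

The sign of the squared pseudoscalar comes from counting transpositions. The clock is compared with
the table case by case; a block and the dimension then determine the matrix size. -/

namespace GeometricAlgebra

/-! ### Recognising a Clifford algebra by its generators and dimension -/

/-- The weights of the signature `(p, q)`: `p` times `+1` and `q` times `-1`. -/
def signature (p q : ℕ) : Fin p ⊕ Fin q → ℝ :=
  Sum.elim (fun _ => 1) (fun _ => -1)

/-- `v` is a family of pairwise anticommuting generators of the real algebra `A`, whose squares
are the scalars `w`, and the dimension of `A` is the largest possible one. -/
structure IsCliffordFamily {ι A : Type*} [Fintype ι] [Ring A] [Algebra ℝ A]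
    (w : ι → ℝ) (v : ι → A) : Prop where
  sq : ∀ i, v i * v i = algebraMap ℝ A (w i)
  anticomm : ∀ i j, i ≠ j → v i * v j = -(v j * v i)
  generates : ∀ S : Subalgebra ℝ A, (∀ i, v i ∈ S) → S = ⊤
  finrank_eq : Module.finrank ℝ A = 2 ^ Fintype.card ι

namespace IsCliffordFamily

variable {ι κ A B : Type*} [Fintype ι] [Fintype κ] [Ring A] [Algebra ℝ A] [Ring B] [Algebra ℝ B]
  {w : ι → ℝ} {v : ι → A}

theorem reindex (h : IsCliffordFamily w v) (e : κ ≃ ι) :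
    IsCliffordFamily (w ∘ e) (v ∘ e) where
  sq i := h.sq (e i)
  anticomm i j hij := h.anticomm _ _ (e.injective.ne hij)
  generates S hS := h.generates S fun i => by simpa using hS (e.symm i)
  finrank_eq := by rw [h.finrank_eq, Fintype.card_congr e]

theorem map (h : IsCliffordFamily w v) (φ : A ≃ₐ[ℝ] B) :
    IsCliffordFamily w (φ ∘ v) where
  sq i := by simp [← map_mul, h.sq]
  anticomm i j hij := by simp [← map_mul, h.anticomm i j hij]
  generates S hS := by
    have h1 := h.generates (S.comap φ.toAlgHom) hS
    refine eq_top_iff.2 fun x _ => ?_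
    have : φ.symm x ∈ S.comap φ.toAlgHom := h1 ▸ Algebra.mem_top
    simpa using this
  finrank_eq := by rw [← φ.toLinearEquiv.finrank_eq, h.finrank_eq]

end IsCliffordFamily

/-- Since 2 is invertible, the Clifford algebra is linearly equivalent to the exterior algebra,
whose basis is indexed by the subsets of a basis of `M`. -/
theorem finrank_cliffordAlgebra {M : Type*} [AddCommGroup M] [Module ℝ M] [FiniteDimensional ℝ M]
    (Q : QuadraticForm ℝ M) :
    FiniteDimensional ℝ (CliffordAlgebra Q) ∧
      Module.finrank ℝ (CliffordAlgebra Q) = 2 ^ Module.finrank ℝ M := by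
  have b := (Module.finBasis ℝ M).ExteriorAlgebra.map
    (CliffordAlgebra.equivExterior Q).symm
  exact ⟨b.finiteDimensional_of_finite, by rw [Module.finrank_eq_card_basis b]; simp⟩

/-- The linear map on coordinates given by a Clifford family satisfies the Clifford relation. -/
theorem IsCliffordFamily.linearCombination_mul_self {p q : ℕ} {A : Type*} [Ring A] [Algebra ℝ A]
    {v : Fin p ⊕ Fin q → A} (h : IsCliffordFamily (signature p q) v) (x : Fin p ⊕ Fin q → ℝ) :
    Fintype.linearCombination ℝ v x * Fintype.linearCombination ℝ v x =
      algebraMap ℝ A (signatureForm p q x) := by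
  have key : ∀ y : Fin p ⊕ Fin q → ℝ, ∀ s : Finset (Fin p ⊕ Fin q),
      (∑ i ∈ s, y i • v i) * (∑ i ∈ s, y i • v i) =
        algebraMap ℝ A (∑ i ∈ s, signature p q i * (y i * y i)) := by
    intro y s
    classical
    induction s using Finset.induction_on with
    | empty => simp
    | insert a s ha ih =>
      -- The cross terms of the square cancel by anticommutation, leaving only the diagonal ones.
      have hc : (y a • v a) * (∑ i ∈ s, y i • v i) + (∑ i ∈ s, y i • v i) * (y a • v a) = 0 := by
        rw [Finset.mul_sum, Finset.sum_mul, ← Finset.sum_add_distrib]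
        refine Finset.sum_eq_zero fun i hi => ?_
        rw [smul_mul_smul_comm, smul_mul_smul_comm, h.anticomm a i (by rintro rfl; exact ha hi),
          mul_comm (y a), smul_neg, neg_add_cancel]
      have hs : (y a • v a) * (y a • v a) =
          algebraMap ℝ A (signature p q a * (y a * y a)) := by
        rw [smul_mul_smul_comm, h.sq, Algebra.smul_def, ← map_mul, mul_comm]
      rw [Finset.sum_insert ha, Finset.sum_insert ha, map_add, ← ih, ← hs, add_mul, mul_add,
        mul_add, ← add_assoc, add_assoc (y a • v a * y a • v a), hc, add_zero]
  rw [Fintype.linearCombination_apply, key]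
  simp only [signatureForm, QuadraticMap.weightedSumSquares_apply, smul_eq_mul, signature]

/-- Generation makes the lifted map surjective; equal finite dimensions make it bijective. Without
the dimension condition proper quotients would qualify, such as ℝ generated by 1 in signature (1,
0). -/
theorem IsCliffordFamily.nonempty_algEquiv {p q : ℕ} {A : Type*} [Ring A] [Algebra ℝ A]
    {v : Fin p ⊕ Fin q → A} (h : IsCliffordFamily (signature p q) v) :
    Nonempty (G p q ≃ₐ[ℝ] A) := by
  let φ : G p q →ₐ[ℝ] A :=
    CliffordAlgebra.lift (signatureForm p q)
      ⟨Fintype.linearCombination ℝ v, h.linearCombination_mul_self⟩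
  have hφ : Function.Surjective φ := by
    rw [← AlgHom.range_eq_top]
    refine h.generates _ fun i => ⟨CliffordAlgebra.ι _ (Pi.single i 1), ?_⟩
    simp [φ]
  obtain ⟨hfin, hdim⟩ := finrank_cliffordAlgebra (signatureForm p q)
  -- `finrank` is 0 in infinite dimension, so a positive value forces finiteness.
  have hA : FiniteDimensional ℝ A := Module.finite_of_finrank_pos (by simp [h.finrank_eq])
  have hd : Module.finrank ℝ (G p q) = Module.finrank ℝ A := by
    rw [hdim, h.finrank_eq]; simp
  exact ⟨AlgEquiv.ofBijective φ
    ⟨(LinearMap.injective_iff_surjective_of_finrank_eq_finrank (f := φ.toLinearMap) hd).2 hφ, hφ⟩⟩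

/-- The real algebra `A` is generated by a Clifford family of signature `(p, q)`. -/
def HasSignature (p q : ℕ) (A : Type*) [Ring A] [Algebra ℝ A] : Prop :=
  ∃ v : Fin p ⊕ Fin q → A, IsCliffordFamily (signature p q) v

/-! ### Recursions between signatures -/

section

variable {ι κ A B : Type*} [Fintype ι] [Fintype κ] [Ring A] [Algebra ℝ A] [Ring B] [Algebra ℝ B]

theorem IsCliffordFamily.hasSignature {w : ι → ℝ} {v : ι → A} (h : IsCliffordFamily w v)
    {p q : ℕ} (e : Fin p ⊕ Fin q ≃ ι) (he : ∀ i, w (e i) = signature p q i) :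
    HasSignature p q A := by
  have := h.reindex e
  rw [show w ∘ e = signature p q from funext he] at this
  exact ⟨_, this⟩

theorem HasSignature.map {p q : ℕ} (h : HasSignature p q A) (φ : A ≃ₐ[ℝ] B) :
    HasSignature p q B :=
  h.imp' _ fun _ hv => hv.map φ

/-- Concatenation of index types of signatures. -/
def signatureEquiv (p q p' q' : ℕ) :
    Fin (p + p') ⊕ Fin (q + q') ≃ (Fin p ⊕ Fin q) ⊕ (Fin p' ⊕ Fin q') :=
  (Equiv.sumCongr finSumFinEquiv.symm finSumFinEquiv.symm).trans (Equiv.sumSumSumComm _ _ _ _)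

theorem signatureEquiv_spec (p q p' q' : ℕ) (i : Fin (p + p') ⊕ Fin (q + q')) :
    Sum.elim (signature p q) (signature p' q') (signatureEquiv p q p' q' i) =
      signature (p + p') (q + q') i := by
  rcases i with i | i <;> refine Fin.addCases (fun i => ?_) (fun i => ?_) i <;>
    simp [signatureEquiv, signature]

open Matrix in
/-- Two further generators with squares `1` and `s`, in the algebra of `2 × 2` matrices. -/
theorem IsCliffordFamily.matrix {w : ι → ℝ} {v : ι → A} (h : IsCliffordFamily w v)
    {s : ℝ} (hs : s * s = 1) :
    IsCliffordFamily (A := Matrix (Fin 2) (Fin 2) A)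
      (Sum.elim (fun i => -s * w i) ![1, s])
      (Sum.elim (fun i => !![0, v i; -s • v i, 0])
        ![!![1, 0; 0, -1], !![0, 1; algebraMap ℝ A s, 0]]) where
  -- The square of `!![0, v; -s • v, 0]` is `-s` times that of `v`: `s = -1` keeps the old signs, `s
  -- = 1` reverses them.
  sq := by
    rintro (i | i)
    · ext a b
      fin_cases a <;> fin_cases b <;>
        simp [h.sq, Matrix.algebraMap_matrix_apply] <;> simp [Algebra.smul_def]
    · fin_cases i <;> ext a b <;> fin_cases a <;> fin_cases b <;>
        simp [Matrix.mul_apply, Matrix.algebraMap_matrix_apply]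
  anticomm := by
    rintro (i | i) (j | j) hij
    · have := h.anticomm i j (by rintro rfl; exact hij rfl)
      ext a b
      fin_cases a <;> fin_cases b <;> simp [Matrix.mul_apply, this]
    · fin_cases j <;> ext a b <;> fin_cases a <;> fin_cases b <;>
        simp [Matrix.mul_apply, Algebra.smul_def, Algebra.commutes]
    · fin_cases i <;> ext a b <;> fin_cases a <;> fin_cases b <;>
        simp [Matrix.mul_apply, Algebra.smul_def, Algebra.commutes]
    · fin_cases i <;> fin_cases j <;> first | exact absurd rfl hij | skip
      all_goals
        ext a b; fin_cases a <;> fin_cases b <;> simp [Algebra.algebraMap_eq_smul_one]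
  generates := by
    intro S hS
    have hZ : (!![1, 0; 0, -1] : Matrix (Fin 2) (Fin 2) A) ∈ S := hS (Sum.inr 0)
    have hY : (!![0, 1; algebraMap ℝ A s, 0] : Matrix (Fin 2) (Fin 2) A) ∈ S := hS (Sum.inr 1)
    have hss : algebraMap ℝ A s * algebraMap ℝ A s = 1 := by rw [← map_mul, hs, map_one]
    let φ : A →ₐ[ℝ] Matrix (Fin 2) (Fin 2) A :=
      (Matrix.diagonalAlgHom ℝ).comp (AlgHom.pi fun _ => AlgHom.id ℝ A)
    have hφ : ∀ a, φ a = !![a, 0; 0, a] := fun a => by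
      ext i j; fin_cases i <;> fin_cases j <;> simp [φ]
    have hdiag : ∀ a, !![a, 0; 0, a] ∈ S := by
      have : S.comap φ = ⊤ := by
        refine h.generates _ fun i => ?_
        rw [Subalgebra.mem_comap, hφ]
        -- The product of the three generators is `-s` times the scalar matrix of `v i`, and `s * s
        -- = 1`.
        have := S.smul_mem (S.mul_mem (S.mul_mem (hS (Sum.inl i)) hZ) hY) (-s)
        convert this using 1
        ext a b
        fin_cases a <;> fin_cases b <;>
          simp [Algebra.smul_def, mul_assoc, Algebra.commutes, hss]
      intro a
      rw [← hφ]
      exact (this ▸ Algebra.mem_top : a ∈ S.comap φ)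
    have h00 : (!![1, 0; 0, 0] : Matrix (Fin 2) (Fin 2) A) ∈ S := by
      convert S.smul_mem (S.add_mem S.one_mem hZ) (1 / 2 : ℝ) using 1
      ext a b
      fin_cases a <;> fin_cases b <;> simp [← two_smul ℝ, smul_smul]
    have h11 : (!![0, 0; 0, 1] : Matrix (Fin 2) (Fin 2) A) ∈ S := by
      convert S.sub_mem S.one_mem h00 using 1
      ext a b
      fin_cases a <;> fin_cases b <;> simp
    refine eq_top_iff.2 fun M _ => ?_
    -- Scalar matrices over `A` and the four matrix units span everything; the off-diagonal units
    -- are obtained by cutting `!![0, 1; s, 0]` with the diagonal idempotents.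
    have : M = !![M 0 0, 0; 0, M 0 0] * !![1, 0; 0, 0] + !![M 1 1, 0; 0, M 1 1] * !![0, 0; 0, 1]
        + !![M 0 1, 0; 0, M 0 1] * (!![1, 0; 0, 0] * !![0, 1; algebraMap ℝ A s, 0])
        + !![M 1 0, 0; 0, M 1 0] *
          (s • (!![0, 0; 0, 1] * !![0, 1; algebraMap ℝ A s, 0])) := by
      ext a b
      fin_cases a <;> fin_cases b <;> simp [Algebra.algebraMap_eq_smul_one, smul_smul, hs]
    rw [this]
    exact S.add_mem (S.add_mem (S.add_mem (S.mul_mem (hdiag _) h00) (S.mul_mem (hdiag _) h11))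
      (S.mul_mem (hdiag _) (S.mul_mem h00 hY)))
      (S.mul_mem (hdiag _) (S.smul_mem (S.mul_mem h11 hY) _))
  finrank_eq := by
    have : Module.Finite ℝ A := Module.finite_of_finrank_pos (by simp [h.finrank_eq])
    rw [Module.finrank_matrix, h.finrank_eq]
    simp [pow_add, mul_comm]

/-- `𝔾_{p+1,q+1}` is the algebra of `2 × 2` matrices over `𝔾_{p,q}`. -/
theorem HasSignature.matrix_succ_succ {p q : ℕ} (h : HasSignature p q A) :
    HasSignature (p + 1) (q + 1) (Matrix (Fin 2) (Fin 2) A) := by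
  obtain ⟨v, hv⟩ := h
  refine (hv.matrix (s := -1) (by norm_num)).hasSignature
    ((signatureEquiv p q 1 1).trans (Equiv.sumCongr (Equiv.refl _) finSumFinEquiv)) fun i => ?_
  rw [← signatureEquiv_spec, Equiv.trans_apply]
  rcases signatureEquiv p q 1 1 i with j | j
  · simp
  · rcases j with j | j <;> fin_cases j <;> simp [signature, finSumFinEquiv]

/-- `𝔾_{q+2,p}` is the algebra of `2 × 2` matrices over `𝔾_{p,q}`. -/
theorem HasSignature.matrix_add_two {p q : ℕ} (h : HasSignature p q A) :
    HasSignature (q + 2) p (Matrix (Fin 2) (Fin 2) A) := by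
  obtain ⟨v, hv⟩ := h
  refine (hv.matrix (s := 1) (by norm_num)).hasSignature
    ((signatureEquiv q p 2 0).trans (Equiv.sumCongr (Equiv.sumComm _ _) (Equiv.sumEmpty _ _)))
    fun i => ?_
  refine Eq.trans ?_ (signatureEquiv_spec q p 2 0 i)
  rw [Equiv.trans_apply]
  rcases signatureEquiv q p 2 0 i with j | j
  · rcases j with j | j <;> simp [signature]
  · rcases j with j | j <;> fin_cases j <;> simp [signature]

/-- The relations satisfied by the product `a b c d` of four anticommuting square roots of `1`. -/
theorem anticommuting_quadruple {R : Type*} [Ring R] {a b c d : R} (ha : a * a = 1) (hb : b * b = 1)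
    (hc : c * c = 1) (hd : d * d = 1) (hba : b * a = -(a * b)) (hca : c * a = -(a * c))
    (hda : d * a = -(a * d)) (hcb : c * b = -(b * c)) (hdb : d * b = -(b * d))
    (hdc : d * c = -(c * d)) :
    (a * b * c * d) * (a * b * c * d) = 1 ∧
      (a * b * c * d) * a = -(a * (a * b * c * d)) ∧
      (a * b * c * d) * b = -(b * (a * b * c * d)) ∧
      (a * b * c * d) * c = -(c * (a * b * c * d)) ∧
      (a * b * c * d) * d = -(d * (a * b * c * d)) := by
  -- Each relation is also needed in front of a tail `t`, so that it can be used inside right-nested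
  -- products.
  have left : ∀ {x y z : R}, x * y = z → ∀ t, x * (y * t) = z * t := fun h t => by
    rw [← mul_assoc, h]
  refine ⟨?_, ?_, ?_, ?_, ?_⟩ <;>
  simp only [mul_assoc, ha, hb, hc, hd, hda, hdb, hdc, left ha, left hb, left hc,
    left hba, left hca, left hda, left hcb, left hdb, left hdc, one_mul, mul_one, mul_neg,
    neg_mul, neg_neg]

/-- Four generators of square `+1` may be exchanged for four generators of square `-1`. -/
theorem IsCliffordFamily.exchange {w : ι → ℝ} {v : Fin 4 ⊕ ι → A}
    (h : IsCliffordFamily (Sum.elim (fun _ => 1) w) v) :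
    IsCliffordFamily (Sum.elim (fun _ => -1) w)
      (Sum.elim
        (fun i => v (.inl i) * (v (.inl 0) * v (.inl 1) * v (.inl 2) * v (.inl 3)))
        (fun i => v (.inr i))) := by
  set ω := v (.inl 0) * v (.inl 1) * v (.inl 2) * v (.inl 3) with hω
  have hsq : ∀ i, v (.inl i) * v (.inl i) = 1 := fun i => by simpa using h.sq (.inl i)
  have hswap : ∀ i j, i ≠ j → v (.inl i) * v (.inl j) = -(v (.inl j) * v (.inl i)) :=
    fun i j hij => h.anticomm _ _ (by simpa using hij)
  obtain ⟨hωω, h0, h1, h2, h3⟩ := anticommuting_quadruple (hsq 0) (hsq 1) (hsq 2) (hsq 3)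
    (hswap 1 0 (by decide)) (hswap 2 0 (by decide)) (hswap 3 0 (by decide))
    (hswap 2 1 (by decide)) (hswap 3 1 (by decide)) (hswap 3 2 (by decide))
  rw [← hω] at hωω h0 h1 h2 h3
  clear_value ω
  have hanti : ∀ i, ω * v (.inl i) = -(v (.inl i) * ω) := by
    intro i
    fin_cases i <;> assumption
  -- Passing through four anticommuting factors changes the sign an even number of times.
  have hcomm : ∀ j, ω * v (.inr j) = v (.inr j) * ω := by
    intro j
    have ha : ∀ i, v (.inl i) * v (.inr j) = -(v (.inr j) * v (.inl i)) := fun i =>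
      h.anticomm _ _ (by simp)
    simp only [hω, mul_assoc, ha, mul_neg]
    simp only [← mul_assoc, ha, mul_neg, neg_mul, neg_neg]
  -- Moving `ω` past `v (.inl j)` costs one sign and `ω * ω = 1`: the squares flip while
  -- anticommutation persists.
  have hmul : ∀ i j, (v (.inl i) * ω) * (v (.inl j) * ω) = -(v (.inl i) * v (.inl j)) := by
    intro i j
    rw [mul_assoc, ← mul_assoc ω, hanti, neg_mul, mul_assoc, hωω, mul_one, mul_neg]
  refine ⟨?_, ?_, fun S hS => ?_, h.finrank_eq⟩
  · rintro (i | i)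
    · simp [hmul, hsq]
    · exact h.sq (.inr i)
  · rintro (i | i) (j | j) hij
    · simp only [Sum.elim_inl, hmul]
      rw [hswap i j (by simpa using hij)]
    · simp only [Sum.elim_inl, Sum.elim_inr]
      rw [mul_assoc, hcomm, ← mul_assoc, h.anticomm _ _ hij, neg_mul, mul_assoc]
    · simp only [Sum.elim_inl, Sum.elim_inr]
      rw [mul_assoc, hcomm, ← mul_assoc, ← mul_assoc, h.anticomm _ _ hij, neg_mul]
    · exact h.anticomm _ _ hij
  -- The product of the four new generators is again `ω`, the two signs from `hmul` cancelling;
  -- multiplying by `ω` then recovers the old generators.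
  · have hωS : ω ∈ S := by
      have := S.mul_mem (S.mul_mem (hS (.inl 0)) (hS (.inl 1)))
        (S.mul_mem (hS (.inl 2)) (hS (.inl 3)))
      simp only [Sum.elim_inl, hmul, neg_mul_neg] at this
      rwa [← mul_assoc, ← hω] at this
    refine h.generates S ?_
    rintro (i | i)
    · have := S.mul_mem (hS (.inl i)) hωS
      simpa only [Sum.elim_inl, mul_assoc, hωω, mul_one] using this
    · exact hS (.inr i)

/-- `𝔾_{p,q+4}` is isomorphic to `𝔾_{p+4,q}`. -/
theorem HasSignature.exchange {p q : ℕ} (h : HasSignature (p + 4) q A) :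
    HasSignature p (q + 4) A := by
  obtain ⟨v, hv⟩ := h
  let σ : Fin 4 ⊕ (Fin p ⊕ Fin q) ≃ Fin (p + 4) ⊕ Fin q :=
    (Equiv.sumAssoc _ _ _).symm.trans
      (Equiv.sumCongr ((Equiv.sumComm _ _).trans finSumFinEquiv) (Equiv.refl _))
  have h1 := hv.reindex σ
  rw [show signature (p + 4) q ∘ σ = Sum.elim (fun _ => 1) (signature p q) by
    ext i; rcases i with i | i | i <;> simp [σ, signature]] at h1
  let τ : Fin p ⊕ Fin (q + 4) ≃ Fin 4 ⊕ (Fin p ⊕ Fin q) :=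
    (Equiv.sumCongr (Equiv.refl _) finSumFinEquiv.symm).trans
      ((Equiv.sumAssoc _ _ _).symm.trans (Equiv.sumComm _ _))
  refine h1.exchange.hasSignature τ fun i => ?_
  rcases i with i | i
  · simp [τ, signature]
  · refine Fin.addCases (fun i => ?_) (fun i => ?_) i <;> simp [τ, signature]

end

/-! ### The five base algebras -/

open Quaternion

theorem hasSignature_real : HasSignature 0 0 ℝ := by
  refine ⟨isEmptyElim, isEmptyElim, isEmptyElim, fun S _ => ?_, by simp⟩
  exact eq_top_iff.2 fun x _ => S.algebraMap_mem x

theorem hasSignature_real_prod_real : HasSignature 1 0 (ℝ × ℝ) := by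
  refine ⟨fun _ => (1, -1), ?_, ?_, fun S hS => ?_, by simp⟩
  · rintro (i | i)
    · ext <;> simp [signature]
    · exact i.elim0
  · rintro (i | i) (j | j) hij
    · exact absurd (by rw [Subsingleton.elim i j]) hij
    all_goals exact isEmptyElim ‹Fin 0›
  · refine eq_top_iff.2 fun x _ => ?_
    convert S.add_mem (S.algebraMap_mem ((x.1 + x.2) / 2))
      (S.smul_mem (hS (.inl 0)) ((x.1 - x.2) / 2)) using 1
    ext <;> simp <;> ring

theorem hasSignature_complex : HasSignature 0 1 ℂ := by
  refine ⟨fun _ => Complex.I, ?_, ?_, fun S hS => ?_, by simp [Complex.finrank_real_complex]⟩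
  · rintro (i | i)
    · exact i.elim0
    · simp [signature]
  · rintro (i | i) (j | j) hij
    · exact i.elim0
    · exact i.elim0
    · exact j.elim0
    · exact absurd (by rw [Subsingleton.elim i j]) hij
  · refine eq_top_iff.2 fun x _ => ?_
    convert S.add_mem (S.algebraMap_mem x.re) (S.smul_mem (hS (.inr 0)) x.im) using 1
    apply Complex.ext <;> simp

/-- The first imaginary quaternion unit. -/
def quaternionI : ℍ[ℝ] := ⟨0, 1, 0, 0⟩

/-- The second imaginary quaternion unit. -/
def quaternionJ : ℍ[ℝ] := ⟨0, 0, 1, 0⟩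

theorem quaternionI_mul_self : quaternionI * quaternionI = -1 := by
  ext <;> simp only [Quaternion.re_mul, Quaternion.imI_mul, Quaternion.imJ_mul,
    Quaternion.imK_mul] <;> simp [quaternionI]

theorem quaternionJ_mul_self : quaternionJ * quaternionJ = -1 := by
  ext <;> simp only [Quaternion.re_mul, Quaternion.imI_mul, Quaternion.imJ_mul,
    Quaternion.imK_mul] <;> simp [quaternionJ]

theorem quaternionJ_mul_I : quaternionJ * quaternionI = -(quaternionI * quaternionJ) := by
  ext <;> simp only [Quaternion.re_mul, Quaternion.imI_mul, Quaternion.imJ_mul,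
    Quaternion.imK_mul, Quaternion.re_neg, Quaternion.imI_neg, Quaternion.imJ_neg,
    Quaternion.imK_neg] <;> simp [quaternionI, quaternionJ]

theorem quaternion_eq_units (x : ℍ[ℝ]) :
    x = (algebraMap ℝ ℍ[ℝ] x.re + x.imI • quaternionI) +
      (x.imJ • quaternionJ + x.imK • (quaternionI * quaternionJ)) := by
  ext <;> simp only [Quaternion.re_mul, Quaternion.imI_mul, Quaternion.imJ_mul,
    Quaternion.imK_mul, Quaternion.re_add, Quaternion.imI_add, Quaternion.imJ_add,
    Quaternion.imK_add, Quaternion.re_smul, Quaternion.imI_smul, Quaternion.imJ_smul,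
    Quaternion.imK_smul, Quaternion.algebraMap_def] <;> simp [quaternionI, quaternionJ]

theorem quaternionK_mul_self :
    quaternionI * quaternionJ * (quaternionI * quaternionJ) = -1 := by
  rw [mul_assoc, ← mul_assoc quaternionJ, quaternionJ_mul_I, neg_mul, mul_assoc,
    quaternionJ_mul_self, mul_neg_one, neg_neg, quaternionI_mul_self]

theorem quaternionK_mul_I :
    quaternionI * quaternionJ * quaternionI = -(quaternionI * (quaternionI * quaternionJ)) := by
  rw [mul_assoc, quaternionJ_mul_I, mul_neg]

theorem quaternionJ_mul_K :
    quaternionJ * (quaternionI * quaternionJ) = -(quaternionI * quaternionJ * quaternionJ) := by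
  rw [← mul_assoc, quaternionJ_mul_I, neg_mul]

theorem hasSignature_quaternion : HasSignature 0 2 ℍ[ℝ] := by
  refine ⟨Sum.elim isEmptyElim ![quaternionI, quaternionJ], ?_, ?_, fun S hS => ?_,
    by simp [Quaternion.finrank_eq_four]⟩
  · rintro (i | i)
    · exact i.elim0
    · fin_cases i <;> simp [signature, quaternionI_mul_self, quaternionJ_mul_self]
  · rintro (i | i) (j | j) hij
    · exact i.elim0
    · exact i.elim0
    · exact j.elim0
    · fin_cases i <;> fin_cases j <;>
        first | exact absurd rfl hij | simp [quaternionJ_mul_I]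
  · refine eq_top_iff.2 fun x _ => ?_
    have hi : quaternionI ∈ S := hS (.inr 0)
    have hj : quaternionJ ∈ S := hS (.inr 1)
    rw [quaternion_eq_units x]
    exact S.add_mem (S.add_mem (S.algebraMap_mem x.re) (S.smul_mem hi x.imI))
      (S.add_mem (S.smul_mem hj x.imJ) (S.smul_mem (S.mul_mem hi hj) x.imK))

/-- The opposite signs in the third generator separate the two factors; with (k, k) only the
diagonal copy of ℍ would be generated. -/
theorem hasSignature_quaternion_prod_quaternion : HasSignature 0 3 (ℍ[ℝ] × ℍ[ℝ]) := by
  refine ⟨Sum.elim isEmptyElim ![(quaternionI, quaternionI), (quaternionJ, quaternionJ),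
    (quaternionI * quaternionJ, -(quaternionI * quaternionJ))], ?_, ?_, fun S hS => ?_,
    by simp [Quaternion.finrank_eq_four]⟩
  · rintro (i | i)
    · exact i.elim0
    · fin_cases i <;> refine Prod.ext ?_ ?_ <;>
        simp [signature, quaternionI_mul_self, quaternionJ_mul_self, quaternionK_mul_self]
  · rintro (i | i) (j | j) hij
    · exact i.elim0
    · exact i.elim0
    · exact j.elim0
    · fin_cases i <;> fin_cases j <;> first
        | exact absurd rfl hij
        | refine Prod.ext ?_ ?_ <;>
            simp [quaternionJ_mul_I, quaternionK_mul_I, quaternionJ_mul_K]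
  · refine eq_top_iff.2 fun x _ => ?_
    have hi : (quaternionI, quaternionI) ∈ S := hS (.inr 0)
    have hj : (quaternionJ, quaternionJ) ∈ S := hS (.inr 1)
    have hk := S.mul_mem hi hj
    -- This is (k, k)(k, -k); with the diagonal copy of ℍ it yields the whole product.
    have hp : ((-1, 1) : ℍ[ℝ] × ℍ[ℝ]) ∈ S := by
      convert S.mul_mem hk (hS (.inr 2)) using 1
      simp [quaternionK_mul_self]
    have hdiag : ∀ y : ℍ[ℝ], (y, y) ∈ S := fun y => by
      convert S.add_mem (S.add_mem (S.algebraMap_mem y.re) (S.smul_mem hi y.imI))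
        (S.add_mem (S.smul_mem hj y.imJ) (S.smul_mem hk y.imK)) using 1
      exact Prod.ext (quaternion_eq_units y) (quaternion_eq_units y)
    convert S.add_mem (hdiag ((1 / 2 : ℝ) • (x.1 + x.2)))
      (S.mul_mem (hdiag ((1 / 2 : ℝ) • (x.2 - x.1))) hp) using 1
    refine Prod.ext ?_ ?_ <;> 
      simp only [Prod.fst_add, Prod.snd_add, Prod.mk_mul_mk, mul_neg_one, mul_one] <;> module

end GeometricAlgebra

/-! ### The table and the clock -/

namespace GeometricAlgebra

open Quaternion

/-- The algebra of `m × m` matrices over the block `K` is generated by a Clifford family of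
signature `(p, q)`. -/
def Block.MatrixHasSignature (p q m : ℕ) : Block → Prop
  | .real => HasSignature p q (Matrix (Fin m) (Fin m) ℝ)
  | .doubleReal => HasSignature p q (Matrix (Fin m) (Fin m) (ℝ × ℝ))
  | .complex => HasSignature p q (Matrix (Fin m) (Fin m) ℂ)
  | .quaternion => HasSignature p q (Matrix (Fin m) (Fin m) ℍ[ℝ])
  | .doubleQuaternion => HasSignature p q (Matrix (Fin m) (Fin m) (ℍ[ℝ] × ℍ[ℝ]))

theorem HasSignature.matrix_one {p q : ℕ} {A : Type*} [Ring A] [Algebra ℝ A]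
    (h : HasSignature p q A) : HasSignature p q (Matrix (Fin 1) (Fin 1) A) :=
  h.map
    { toFun := fun a => Matrix.of fun _ _ => a
      invFun := fun M => M 0 0
      left_inv := fun _ => rfl
      right_inv := fun M => by ext i j; simp [Subsingleton.elim i 0, Subsingleton.elim j 0]
      map_mul' := fun a b => by ext; simp [Matrix.mul_apply]
      map_add' := fun a b => rfl
      commutes' := fun r => by ext i j; simp [Matrix.algebraMap_matrix_apply, Subsingleton.elim i j] }

theorem HasSignature.matrix_mul {p q m n : ℕ} {A : Type*} [Ring A] [Algebra ℝ A]
    (h : HasSignature p q (Matrix (Fin m) (Fin m) (Matrix (Fin n) (Fin n) A))) :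
    HasSignature p q (Matrix (Fin (m * n)) (Fin (m * n)) A) :=
  h.map ((Matrix.compAlgEquiv (Fin m) (Fin n) A ℝ).trans
    (Matrix.reindexAlgEquiv ℝ A finProdFinEquiv))

namespace Block.MatrixHasSignature

variable {p q m : ℕ} {K : Block}

theorem isMatrixAlgebraOver (h : K.MatrixHasSignature p q m) :
    IsMatrixAlgebraOver (G p q) m K := by
  cases K <;> exact h.elim fun _ hv => hv.nonempty_algEquiv

theorem succ_succ (h : K.MatrixHasSignature p q m) :
    K.MatrixHasSignature (p + 1) (q + 1) (2 * m) := by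
  cases K <;> exact h.matrix_succ_succ.matrix_mul

theorem add_two (h : K.MatrixHasSignature p q m) : K.MatrixHasSignature (q + 2) p (2 * m) := by
  cases K <;> exact h.matrix_add_two.matrix_mul

theorem exchange (h : K.MatrixHasSignature (p + 4) q m) : K.MatrixHasSignature p (q + 4) m := by
  cases K <;> exact HasSignature.exchange h

theorem real : Block.real.MatrixHasSignature 0 0 1 :=
  hasSignature_real.matrix_one

theorem doubleReal : Block.doubleReal.MatrixHasSignature 1 0 1 :=
  hasSignature_real_prod_real.matrix_one

theorem complex : Block.complex.MatrixHasSignature 0 1 1 :=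
  hasSignature_complex.matrix_one

theorem quaternion : Block.quaternion.MatrixHasSignature 0 2 1 :=
  hasSignature_quaternion.matrix_one

theorem doubleQuaternion : Block.doubleQuaternion.MatrixHasSignature 0 3 1 :=
  hasSignature_quaternion_prod_quaternion.matrix_one

end Block.MatrixHasSignature

theorem Block.dim_eq (K : Block) : K.dim = match K with
    | .real => 1
    | .doubleReal => 2
    | .complex => 2
    | .quaternion => 4
    | .doubleQuaternion => 8 := by
  cases K <;> simp [Block.dim, Complex.finrank_real_complex, Quaternion.finrank_eq_four]

/-- The algebra named by the entry of the table at `(p, q)` has signature `(p, q)`. -/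
theorem exists_tableEntry (p q : ℕ) (hpq : p + q ≤ 7) :
    ∃ m K, tableEntry p q = some (m, K) ∧ Block.MatrixHasSignature p q m K := by
  have h00 := Block.MatrixHasSignature.real
  have h10 := Block.MatrixHasSignature.doubleReal
  have h01 := Block.MatrixHasSignature.complex
  have h02 := Block.MatrixHasSignature.quaternion
  have h03 := Block.MatrixHasSignature.doubleQuaternion
  have h20 := h00.add_two
  have h30 := h01.add_two
  have h40 := h02.add_two
  have h50 := h03.add_two
  -- The remaining negative definite signatures (0, n) come from (4, n - 4), which `succ_succ`
  -- reaches from (8 - n, 0). With `h60` and `h70` all definite signatures are available.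
  have h04 := h40.exchange
  have h05 := h30.succ_succ.exchange
  have h06 := h20.succ_succ.succ_succ.exchange
  have h07 := h10.succ_succ.succ_succ.succ_succ.exchange
  have h60 := h04.add_two
  have h70 := h05.add_two
  have hp : p ≤ 7 := by omega
  have hq : q ≤ 7 := by omega
  interval_cases p <;> interval_cases q <;> first
    | exact absurd hpq (by decide)
    | refine ⟨_, _, rfl, ?_⟩
      -- A mixed signature descends to a definite one by min(p, q) ≤ 3 uses of `succ_succ`; `m` is
      -- half the matrix size in the goal.
      first
        | assumption
        | apply Block.MatrixHasSignature.succ_succ (m := 1); assumption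
        | apply Block.MatrixHasSignature.succ_succ (m := 2); assumption
        | apply Block.MatrixHasSignature.succ_succ (m := 4); assumption
        | apply Block.MatrixHasSignature.succ_succ (m := 2)
          apply Block.MatrixHasSignature.succ_succ (m := 1); assumption
        | apply Block.MatrixHasSignature.succ_succ (m := 4)
          apply Block.MatrixHasSignature.succ_succ (m := 2); assumption
        | apply Block.MatrixHasSignature.succ_succ (m := 4)
          apply Block.MatrixHasSignature.succ_succ (m := 2)
          apply Block.MatrixHasSignature.succ_succ (m := 1); assumption

/-- The Clifford clock and the dimension determine the entries of the table. -/
theorem tableEntry_eq_some_iff (p q : ℕ) (hpq : p + q ≤ 7) (m : ℕ) (K : Block) :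
    tableEntry p q = some (m, K) ↔
      K = cliffordClock ((q : ZMod 8) - (p : ZMod 8)) ∧ m ^ 2 * K.dim = 2 ^ (p + q) := by
  -- The entry is unique, so it suffices that it satisfies the two conditions and that these
  -- determine a pair: the clock fixes the block, the dimension then fixes the square of the size.
  obtain ⟨n, L, hL, hclock, hdim⟩ : ∃ n L, tableEntry p q = some (n, L) ∧
      L = cliffordClock ((q : ZMod 8) - (p : ZMod 8)) ∧ n ^ 2 * L.dim = 2 ^ (p + q) := by
    have hp : p ≤ 7 := by omega
    have hq : q ≤ 7 := by omega
    simp only [Block.dim_eq]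
    interval_cases p <;> interval_cases q <;> first
      | exact absurd hpq (by decide)
      | exact ⟨_, _, rfl, rfl, rfl⟩
  rw [hL, Option.some.injEq, Prod.mk.injEq]
  refine ⟨fun ⟨h, h'⟩ => h ▸ h' ▸ ⟨hclock, hdim⟩, fun ⟨h, h'⟩ => ?_⟩
  have hLK : L = K := hclock.trans h.symm
  subst hLK
  refine ⟨?_, rfl⟩
  have hpos : 0 < L.dim := by rw [Block.dim_eq]; cases L <;> simp
  exact Nat.pow_left_injective two_ne_zero (Nat.eq_of_mul_eq_mul_right hpos (hdim.trans h'.symm))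

/-! ### The square of the pseudoscalar -/

section

variable {R : Type*} [CommRing R] {A : Type*} [Ring A] [Algebra R A]

/-- An element anticommuting with each factor of a product of `n` factors commutes with the product
up to the sign `(-1) ^ n`. -/
theorem list_prod_mul_of_anticomm (l : List A) (x : A) (h : ∀ y ∈ l, y * x = -(x * y)) :
    l.prod * x = (-1) ^ l.length * (x * l.prod) := by
  induction l with
  | nil => simp
  | cons y l ih =>
    rw [List.prod_cons, mul_assoc, ih fun z hz => h z (by simp [hz]), List.length_cons,
      ← mul_assoc, ((Commute.neg_one_right y).pow_right _).eq, mul_assoc, ← mul_assoc y,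
      h y (by simp), pow_succ]
    simp [mul_assoc]

/-- The square of a product of pairwise anticommuting elements of scalar squares. -/
theorem list_prod_sq_of_anticomm (l : List (A × R))
    (hsq : ∀ x ∈ l, x.1 * x.1 = algebraMap R A x.2)
    (hanti : l.Pairwise fun x y => y.1 * x.1 = -(x.1 * y.1)) :
    (l.map Prod.fst).prod ^ 2 =
      algebraMap R A ((-1) ^ (l.length.choose 2) * (l.map Prod.snd).prod) := by
  induction l with
  | nil => simp
  | cons x l ih =>
    rw [List.pairwise_cons] at hanti
    have ih := ih (fun y hy => hsq y (by simp [hy])) hanti.2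
    -- With P the product of the n remaining factors, (xP)² = (-1)ⁿ x² P², and n + C(n, 2) = C(n +
    -- 1, 2).
    have hx := list_prod_mul_of_anticomm (l.map Prod.fst) x.1 (by simpa using hanti.1)
    rw [sq] at ih ⊢
    rw [List.map_cons, List.prod_cons, mul_assoc, ← mul_assoc _ x.1, hx, List.length_map,
      mul_assoc _ (x.1 * _), ← mul_assoc x.1 ((-1) ^ _),
      ((Commute.neg_one_right x.1).pow_right _).eq, mul_assoc, ← mul_assoc x.1,
      ← mul_assoc x.1 x.1, mul_assoc (x.1 * x.1), hsq x (by simp), ih, List.map_cons,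
      List.prod_cons, List.length_cons, Nat.choose_succ_succ' _ 1, Nat.choose_one_right, pow_add]
    simp only [map_mul, map_pow, map_neg, map_one]
    rw [mul_assoc, ← mul_assoc (algebraMap R A x.2), Algebra.commutes x.2 ((-1) ^ _)]
    simp only [mul_assoc]

end

theorem signatureForm_single (p q : ℕ) (i : Fin p ⊕ Fin q) :
    signatureForm p q (Pi.single i 1) = signature p q i := by
  simp [signatureForm, signature, Pi.single_apply]

/-- Distinct coordinate vectors are orthogonal because the form is diagonal. -/
theorem ι_single_anticomm {p q : ℕ} {i j : Fin p ⊕ Fin q} (hij : i ≠ j) :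
    (CliffordAlgebra.ι (signatureForm p q) (Pi.single j 1) : G p q) *
        CliffordAlgebra.ι (signatureForm p q) (Pi.single i 1) =
      -(CliffordAlgebra.ι (signatureForm p q) (Pi.single i 1) *
        CliffordAlgebra.ι (signatureForm p q) (Pi.single j 1)) := by
  refine CliffordAlgebra.ι_mul_ι_comm_of_isOrtho ?_
  rw [QuadraticMap.isOrtho_def, signatureForm_single, signatureForm_single]
  simp only [signatureForm, QuadraticMap.weightedSumSquares_apply, signature]
  rw [← Finset.sum_subset (Finset.subset_univ {i, j}), Finset.sum_pair hij]
  · simp [hij, hij.symm, add_comm]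
  · simp +contextual

/-- The binomial coefficient counts the transpositions, and `q` the generators of square -1. -/
theorem pseudoscalar_sq (p q : ℕ) :
    pseudoscalar p q ^ 2 = algebraMap ℝ (G p q) ((-1) ^ ((p + q).choose 2 + q)) := by
  let g : Fin p ⊕ Fin q → G p q × ℝ := fun i =>
    (CliffordAlgebra.ι (signatureForm p q) (Pi.single i 1), signature p q i)
  let l : List (Fin p ⊕ Fin q) := List.ofFn (fun i : Fin p => Sum.inl i) ++
    List.ofFn (fun j : Fin q => Sum.inr j)
  have hl : l.Pairwise (· ≠ ·) := by
    refine List.Nodup.append ?_ ?_ ?_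
    · exact List.nodup_ofFn.2 Sum.inl_injective
    · exact List.nodup_ofFn.2 Sum.inr_injective
    · simp [List.Disjoint]
  have hg : ∀ x ∈ l.map g, x.1 * x.1 = algebraMap ℝ (G p q) x.2 := by
    intro x hx
    obtain ⟨i, -, rfl⟩ := List.mem_map.1 hx
    rw [CliffordAlgebra.ι_sq_scalar, signatureForm_single]
  have h := list_prod_sq_of_anticomm (l.map g) hg
    (List.pairwise_map.2 (hl.imp fun hij => ι_single_anticomm hij))
  have h1 : ((l.map g).map Prod.fst).prod = pseudoscalar p q := by
    simp only [l, g, List.map_append, List.map_ofFn, List.prod_append]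
    rfl
  have h2 : ((l.map g).map Prod.snd).prod = (-1) ^ q := by
    simp only [l, g, List.map_append, List.map_ofFn, List.prod_append, List.prod_ofFn]
    simp [signature]
  rw [h1, h2, ← pow_add] at h
  simpa [l] using h

/-- With d = p - q the exponent has the parity of d(d - 1)/2, so one row indexed by d suffices. The
row starts at d = 7, hence position 7 - d; the natural subtraction does not truncate since p ≤ 7. -/
theorem exists_signRow (p q : ℕ) (hpq : p + q ≤ 7) :
    ∃ s : ℤ, signRow[7 + q - p]? = some s ∧ s = (-1) ^ ((p + q).choose 2 + q) := by
  have hp : p ≤ 7 := by omega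
  have hq : q ≤ 7 := by omega
  interval_cases p <;> interval_cases q <;> first
    | exact absurd hpq (by decide)
    | exact ⟨_, rfl, by decide⟩

end GeometricAlgebra

theorem mainTheorem4 (p q : ℕ) (hpq : p + q ≤ 7) :
    -- the entry of the table at `𝔾_{p,q}` is a matrix algebra isomorphic to `𝔾_{p,q}`
    (∃ (m : ℕ) (K : GeometricAlgebra.Block),
      GeometricAlgebra.tableEntry p q = some (m, K) ∧
      GeometricAlgebra.IsMatrixAlgebraOver (GeometricAlgebra.G p q) m K) ∧
    -- the last line of the table, read in the column `p - q`, is the square of the pseudoscalar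
    (∃ s : ℤ, GeometricAlgebra.signRow[7 + q - p]? = some s ∧
      GeometricAlgebra.pseudoscalar p q ^ 2 =
        algebraMap ℝ (GeometricAlgebra.G p q) (s : ℝ)) ∧
    -- the entry is what the Clifford clock gives, after `q` hours clockwise and then `p` hours
    -- counterclockwise, the matrix size being fixed by the number `p + q` of hours elapsed
    (∀ (m : ℕ) (K : GeometricAlgebra.Block),
      GeometricAlgebra.tableEntry p q = some (m, K) ↔
        K = GeometricAlgebra.cliffordClock ((q : ZMod 8) - (p : ZMod 8)) ∧
        m ^ 2 * K.dim = 2 ^ (p + q)) := by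
  open GeometricAlgebra in
  refine ⟨?_, ?_, tableEntry_eq_some_iff p q hpq⟩
  · obtain ⟨m, K, hK, h⟩ := exists_tableEntry p q hpq
    exact ⟨m, K, hK, h.isMatrixAlgebraOver⟩
  · obtain ⟨s, hs, rfl⟩ := exists_signRow p q hpq
    exact ⟨_, hs, by rw [pseudoscalar_sq]; push_cast; rfl⟩
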